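/- Let $\mathcal G=(\mathcal V,\mathcal E)$ be a finite simple undirected graph, $N\ge 1$ an integer and $\beta\ge 0$ a real number. **Random path model.** A wire configuration is a triple $w=(m,c,\pi)$: $m=(m_e)_{e\in\mathcal E}\in\mathbb N^{\mathcal E}$ gives the number of links on each edge ($\mathbb N\ni 0$; the links on $e$ are labelled $1,\dots,m_e$); $c$ gives each link a colour in $\{1,\dots,N\}$; and $\pi=(\pi_x)_{x\in\mathcal V}$, where $\pi_x$ is a partial matching of the links touching $x$ (those on edges incident to $x$) in which only links of equal colour are matched. For $x\in\mathcal V$ let $u^i_x(w)$ and $v^i_x(w)$ be the numbers of links of colour $i$ touching $x$ that are unmatched, respectively matched, by $\pi_x$. Put $n^i_x=\tfrac12 v^i_x+u^i_x$, $\mathbf n_x=(n^1_x,\dots,n^N_x)$, $\mathbf u_x=(u^1_x,\dots,u^N_x)$, and let $t_x$ be the number of links touching $x$ that $\pi_x$ matches to another link on the same edge. For $U:\mathbb N^{2N+1}\to\mathbb R_{\ge0}$ let $\mu_U$ be the measure on the set of wire configurations with $$\mu_U(\{w\})=\prod_{e\in\mathcal E}\frac{\beta^{m_e}}{m_e!}\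 \prod_{x\in\mathcal V}U(\mathbf n_x(w),\mathbf u_x(w),t_x(w)).$$ For $A\subset\mathcal V$ let $\mathcal S_A$ be the set of all $w$ with $u^1_x(w)=1$ for $x\in A$ and $u^1_x(w)=0$ for $x\in\mathcal V\setminus A$. Let $Z_U(A)=\mu_U(\mathcal S_A)$, with the convention $Z_U(\emptyset)=1$ if $\mu_U(\mathcal S_\emptyset)=0$, and $G_U(A)=Z_U(A)/Z_U(\emptyset)$. **Spin $O(N)$ model.** For $f:(\mathbb S^{N-1})^{\mathcal V}\to\mathbb R$ let $$\langle f\rangle=\frac{\int f(\varphi)\,e^{\beta\sum_{\{x,y\}\in\mathcal E}\varphi_x\cdot\varphi_y}\prod_{x\in\mathcal V}d\varphi_x}{\int e^{\beta\sum_{\{x,y\}\in\mathcal E}\varphi_x\cdot\varphi_y}\prod_{x\in\mathcal V}d\varphi_x},$$ where $d\varphi_x$ is the uniform probability measure on the unit sphere $\mathbb S^{N-1}\subset\mathbb R^N$ and $\varphi_x=(\varphi^1_x,\dots,\varphi^N_x)$. **Proposition.** Let $$U(\mathbf n,\mathbf u,t)=\begin{cases}\dfrac{\Gamma(N/2)}{2^{n}\,\Gamma(n+N/2)}&\text{if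 }u_2=\dots=u_N=0,\\[1ex]0&\text{otherwise,}\end{cases}\qquad n=n_1+\dots+n_N .$$ Then $\mu_U(\mathcal S_A)<\infty$ for every $A\subset\mathcal V$, and for every $A\subset\mathcal V$ $$\Big\langle\prod_{x\in A}\varphi^1_x\Big\rangle=G_U(A).$$ -/

import Mathlib

open MeasureTheory
open scoped NNReal ENNReal

namespace RandomPath

section Configurations

variable {V : Type*} {G : SimpleGraph V} {N : ℕ}

/-- A link configuration `m`: the number `m e` of parallel links on every edge `e`. -/
abbrev LinkCount (G : SimpleGraph V) : Type _ := G.edgeSet → ℕ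

/-- The links of `m`: pairs `(e, p)` where `p` is one of the `m e` links parallel to `e`. -/
abbrev Link (m : LinkCount G) : Type _ := Σ e : G.edgeSet, Fin (m e)

/-- The links touching the vertex `x`, that is, those on the edges incident to `x`. -/
abbrev LinkAt (m : LinkCount G) (x : V) : Type _ := {l : Link m // x ∈ (l.1 : Sym2 V)}

/-- A colouring gives every link a colour. The colours are indexed by `Fin N`, so that
the colours `1, …, N` are the indices `0, …, N - 1`; in particular colour `1` is `0 : Fin N`. -/
abbrev Colouring (m : LinkCount G) (N : ℕ) : Type _ := Link m → Fin N

/-- A pairing: at every vertex `x` a partial matching of the links touching `x` in which paired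
links have the same colour. The matching at `x` is encoded by the involution of the links
touching `x` that exchanges the two links of each pair and fixes every unpaired link. -/
abbrev Pairing (m : LinkCount G) (c : Colouring m N) : Type _ :=
  (x : V) → {σ : LinkAt m x → LinkAt m x //
    Function.Involutive σ ∧ ∀ l : LinkAt m x, c (σ l).1 = c l.1}

/-- A wire configuration `w = (m, c, π)`. -/
structure WireConfig {V : Type*} (G : SimpleGraph V) (N : ℕ) where
  /-- the link configuration -/
  m : LinkCount G
  /-- the colouring -/
  c : Colouring m N
  /-- the pairings -/
  π : Pairing m c

/-- Every set of wire configurations is measurable. -/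
instance : MeasurableSpace (WireConfig G N) := ⊤

end Configurations

section Model

variable {V : Type*} [Fintype V] [DecidableEq V] {G : SimpleGraph V} [DecidableRel G.Adj] {N : ℕ}

/-- `u^i_x(w)`: the number of `i`-links touching `x` that are unpaired at `x`. -/
def WireConfig.u (w : WireConfig G N) (x : V) (i : Fin N) : ℕ :=
  (Finset.univ.filter fun l : LinkAt w.m x => w.c l.1 = i ∧ (w.π x).1 l = l).card

/-- `v^i_x(w)`: the number of `i`-links touching `x` that are paired at `x` to another link. -/
def WireConfig.v (w : WireConfig G N) (x : V) (i : Fin N) : ℕ :=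
  (Finset.univ.filter fun l : LinkAt w.m x => w.c l.1 = i ∧ (w.π x).1 l ≠ l).card

/-- The number of paired `i`-links at a vertex is even. -/
theorem WireConfig.even_v (w : WireConfig G N) (x : V) (i : Fin N) : Even (w.v x i) := by
  have key : ((w.v x i : ℕ) : ZMod 2) = 0 := by
    have h : ∑ _l ∈ (Finset.univ.filter fun l : LinkAt w.m x =>
        w.c l.1 = i ∧ (w.π x).1 l ≠ l), (1 : ZMod 2) = 0 := by
      refine Finset.sum_involution (fun l _ => (w.π x).1 l) ?_ ?_ ?_ ?_
      · intro l _
        decide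
      · intro l hl _
        exact (Finset.mem_filter.mp hl).2.2
      · intro l hl
        have hl' := (Finset.mem_filter.mp hl).2
        refine Finset.mem_filter.mpr ⟨Finset.mem_univ _, ?_, ?_⟩
        · rw [(w.π x).2.2 l]
          exact hl'.1
        · rw [(w.π x).2.1 l]
          exact fun h => hl'.2 h.symm
      · intro l _
        exact (w.π x).2.1 l
    simpa [WireConfig.v] using h
  exact (ZMod.natCast_eq_zero_iff_even).mp key

/-- `n^i_x(w) = v^i_x(w) / 2 + u^i_x(w)`: the number of visits of paths of colour `i` at `x`.
The division is exact by `WireConfig.even_v`. -/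
def WireConfig.n (w : WireConfig G N) (x : V) (i : Fin N) : ℕ := w.v x i / 2 + w.u x i

/-- `t_x(w)`: the number of links touching `x` that are paired at `x` to another link on the
same edge. -/
def WireConfig.t (w : WireConfig G N) (x : V) : ℕ :=
  (Finset.univ.filter fun l : LinkAt w.m x =>
    (w.π x).1 l ≠ l ∧ ((w.π x).1 l).1.1 = l.1.1).card

/-- A weight function `U(n, u, t)` of `n, u ∈ ℕ^N` and `t ∈ ℕ`. -/
abbrev WeightFunction (N : ℕ) : Type := (Fin N → ℕ) → (Fin N → ℕ) → ℕ → ℝ≥0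

/-- The weight `∏_e β ^ m_e / m_e! * ∏_x U(n_x, u_x, t_x)` of a wire configuration. -/
noncomputable def weight (β : ℝ≥0) (U : WeightFunction N) (w : WireConfig G N) : ℝ≥0 :=
  (∏ e : G.edgeSet, β ^ w.m e / ((w.m e).factorial : ℝ≥0)) *
    ∏ x : V, U (w.n x) (w.u x) (w.t x)

/-- The measure of the random path model on the (countable) set of wire configurations,
which gives mass `weight β U w` to every `w`. -/
noncomputable def pathMeasure (G : SimpleGraph V) [DecidableRel G.Adj] (β : ℝ≥0)
    (U : WeightFunction N) : Measure (WireConfig G N) :=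
  Measure.sum fun w => (weight β U w : ℝ≥0∞) • Measure.dirac w

/-- The set `S_A` of configurations with exactly one unpaired `1`-link at every vertex of `A`
and none at the other vertices. -/
def endpointSet [NeZero N] (G : SimpleGraph V) [DecidableRel G.Adj] (A : Finset V) :
    Set (WireConfig G N) :=
  {w | (∀ x ∈ A, w.u x 0 = 1) ∧ ∀ z ∉ A, w.u z 0 = 0}

open Classical in
/-- `Z(A)`, the mass of `S_A`, with the convention that `Z(∅) = 1` if `S_∅` has mass zero. -/
noncomputable def partitionFunction [NeZero N] (G : SimpleGraph V) [DecidableRel G.Adj]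
    (β : ℝ≥0) (U : WeightFunction N) (A : Finset V) : ℝ≥0∞ :=
  if A = ∅ ∧ pathMeasure G β U (endpointSet G ∅) = 0 then 1
  else pathMeasure G β U (endpointSet G A)

/-- The two-point function `G(A) = Z(A) / Z(∅)`. -/
noncomputable def twoPoint [NeZero N] (G : SimpleGraph V) [DecidableRel G.Adj] (β : ℝ≥0)
    (U : WeightFunction N) (A : Finset V) : ℝ :=
  (partitionFunction G β U A).toReal / (partitionFunction G β U ∅).toReal

/-- The weight function `Γ(N/2) / (2^n Γ(n + N/2))`, `n = n_1 + … + n_N`, if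
`u_2 = … = u_N = 0`, and `0` otherwise. -/
noncomputable def spinWeight (N : ℕ) [NeZero N] : WeightFunction N := fun n u _ =>
  if ∀ i : Fin N, i ≠ 0 → u i = 0 then
    ⟨Real.Gamma ((N : ℝ) / 2) /
        (2 ^ (∑ i, n i) * Real.Gamma (((∑ i, n i : ℕ) : ℝ) + (N : ℝ) / 2)),
      div_nonneg (Real.Gamma_nonneg_of_nonneg (by positivity))
        (mul_nonneg (by positivity) (Real.Gamma_nonneg_of_nonneg (by positivity)))⟩
  else 0

end Model

section Spin

variable {V : Type*} [Fintype V] [DecidableEq V]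

/-- The unit sphere of `ℝ^N`. -/
abbrev Sphere (N : ℕ) : Type := Metric.sphere (0 : EuclideanSpace ℝ (Fin N)) 1

/-- The uniform probability measure on the unit sphere: the surface measure divided by its
total mass. -/
noncomputable def uniformSphere (N : ℕ) : Measure (Sphere N) :=
  ((volume : Measure (EuclideanSpace ℝ (Fin N))).toSphere Set.univ)⁻¹ •
    (volume : Measure (EuclideanSpace ℝ (Fin N))).toSphere

/-- The inner product `φ_x · φ_y` of the spins at the end-points of `{x, y}`. -/
noncomputable def edgeInner {N : ℕ} (φ : V → Sphere N) : Sym2 V → ℝ :=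
  Sym2.lift ⟨fun x y => inner ℝ (φ x : EuclideanSpace ℝ (Fin N)) (φ y),
    fun _ _ => real_inner_comm _ _⟩

/-- The Hamiltonian `H(φ) = - ∑_{{x, y} ∈ E} φ_x · φ_y`. -/
noncomputable def hamiltonian (G : SimpleGraph V) [DecidableRel G.Adj] {N : ℕ}
    (φ : V → Sphere N) : ℝ :=
  - ∑ e ∈ G.edgeFinset, edgeInner φ e

/-- The partition function of the spin `O(N)` model. -/
noncomputable def spinPartition (G : SimpleGraph V) [DecidableRel G.Adj] (N : ℕ) (β : ℝ) : ℝ :=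
  ∫ φ : V → Sphere N, Real.exp (-β * hamiltonian G φ) ∂(Measure.pi fun _ => uniformSphere N)

/-- The expectation `⟨f⟩` in the spin `O(N)` model. -/
noncomputable def spinExpectation (G : SimpleGraph V) [DecidableRel G.Adj] (N : ℕ) (β : ℝ)
    (f : (V → Sphere N) → ℝ) : ℝ :=
  (spinPartition G N β)⁻¹ *
    ∫ φ : V → Sphere N, f φ * Real.exp (-β * hamiltonian G φ)
      ∂(Measure.pi fun _ => uniformSphere N)

end Spin

end RandomPath

/-! Expand `exp (β ∑ φ_x · φ_y)` edge by edge: the power series gives link numbers `m` with weights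
`β ^ m_e / m_e!`, and choosing one coordinate of the inner product for each link gives a colouring.
Since the reference measure is a product, each term factors over vertices into moments of the
uniform measure on the sphere, where the factor `φ_x^1` for `x ∈ A` raises the exponent of colour
`1` by one (`hasSum_integral_prod_mul_exp`).

Such a moment vanishes unless all exponents are even. Otherwise it is a Gamma quotient times a
product of double factorials (`integral_uniformSphere_monomial`). The product counts the admissible
pairings at the vertex, and the quotient is exactly `spinWeight` (`tsum_localWeight`). Hence
`μ_U(S_A)` equals the unnormalised spin correlation (`pathMeasure_endpointSet`), which gives both
finiteness and, after division by the case `A = ∅`, the equality of the correlations. -/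

namespace RandomPath

/-! ### Moments of the uniform measure on the sphere, from Gaussian integrals. -/

section SphereMoments

theorem integral_pow_mul_exp_neg_sq_Ioi (k : ℕ) :
    ∫ x in Set.Ioi (0 : ℝ), x ^ k * Real.exp (-x ^ 2) = Real.Gamma (((k : ℝ) + 1) / 2) / 2 := by
  have h := integral_rpow_mul_exp_neg_rpow (p := 2) (q := k) (by norm_num)
    (by have : (0 : ℝ) ≤ k := k.cast_nonneg
        linarith)
  rw [div_eq_inv_mul, ← one_div, ← h]
  norm_cast

theorem integral_pow_mul_exp_neg_sq_of_even {k : ℕ} (hk : Even k) :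
    ∫ x : ℝ, x ^ k * Real.exp (-x ^ 2) = Real.Gamma (((k : ℝ) + 1) / 2) := by
  have h := integral_comp_abs (f := fun x : ℝ => x ^ k * Real.exp (-x ^ 2))
  simp only [hk.pow_abs, sq_abs] at h
  rw [h, integral_pow_mul_exp_neg_sq_Ioi]
  ring

theorem integral_pow_mul_exp_neg_sq_of_not_even {k : ℕ} (hk : ¬ Even k) :
    ∫ x : ℝ, x ^ k * Real.exp (-x ^ 2) = 0 := by
  have h := integral_neg_eq_self (fun x : ℝ => x ^ k * Real.exp (-x ^ 2)) volume
  simp only [(Nat.not_even_iff_odd.mp hk).neg_pow, even_two.neg_pow, neg_mul,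
    integral_neg] at h
  linarith

theorem integral_monomial_mul_exp_neg_norm_sq {N : ℕ} (a : Fin N → ℕ) :
    ∫ x : EuclideanSpace ℝ (Fin N), (∏ i, x i ^ a i) * Real.exp (-‖x‖ ^ 2) =
      ∏ i, ∫ x : ℝ, x ^ a i * Real.exp (-x ^ 2) := by
  rw [← integral_fintype_prod_eq_prod (fun i (x : ℝ) => x ^ a i * Real.exp (-x ^ 2)),
    ← volume_pi, ← (EuclideanSpace.volume_preserving_symm_measurableEquiv_toLp (Fin N)).integral_comp
      (MeasurableEquiv.measurableEmbedding _)]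
  refine integral_congr_ae (.of_forall fun x => ?_)
  simp [Finset.prod_mul_distrib, EuclideanSpace.norm_sq_eq, ← Real.exp_sum]

/-- Polar coordinates: homogeneity splits the integrand into an angular and a radial factor, and the
radial integral is a Gamma value. -/
theorem integral_homogeneous_mul_exp_neg_norm_sq {E : Type*} [NormedAddCommGroup E]
    [NormedSpace ℝ E] [MeasurableSpace E] [BorelSpace E] [FiniteDimensional ℝ E] [Nontrivial E]
    (μ : Measure E) [μ.IsAddHaarMeasure] (f : E → ℝ) (k : ℕ)
    (hf : ∀ (r : ℝ) (x : E), f (r • x) = r ^ k * f x) :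
    ∫ x, f x * Real.exp (-‖x‖ ^ 2) ∂μ =
      (∫ φ : Metric.sphere (0 : E) 1, f φ ∂μ.toSphere) *
        (Real.Gamma (((k : ℝ) + Module.finrank ℝ E) / 2) / 2) := by
  set d := Module.finrank ℝ E
  have hd : 0 < d := Module.finrank_pos
  calc
    _ = ∫ x : ({0}ᶜ : Set E), f x * Real.exp (-‖x.1‖ ^ 2) ∂(μ.comap (↑)) := by
      rw [integral_subtype_comap (measurableSet_singleton _).compl
        fun x ↦ f x * Real.exp (-‖x‖ ^ 2), restrict_compl_singleton]
    _ = ∫ p : Metric.sphere (0 : E) 1 × Set.Ioi (0 : ℝ),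
          f p.1 * ((p.2 : ℝ) ^ k * Real.exp (-(p.2 : ℝ) ^ 2))
          ∂μ.toSphere.prod (.volumeIoiPow (d - 1)) := by
      rw [← μ.measurePreserving_homeomorphUnitSphereProd.integral_comp
        (Homeomorph.measurableEmbedding _)]
      refine integral_congr_ae (.of_forall fun x => ?_)
      have hx : ‖(x : E)‖ ≠ 0 := norm_ne_zero_iff.mpr x.2
      have : (x : E) = ‖(x : E)‖ • (‖(x : E)‖⁻¹ • (x : E)) := by
        rw [smul_smul, mul_inv_cancel₀ hx, one_smul]
      simp only [homeomorphUnitSphereProd_apply_fst_coe, homeomorphUnitSphereProd_apply_snd_coe]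
      conv_lhs => rw [this, hf]
      rw [← this]
      ring
    _ = (∫ φ : Metric.sphere (0 : E) 1, f φ ∂μ.toSphere) *
        ∫ r : Set.Ioi (0 : ℝ), (r : ℝ) ^ k * Real.exp (-(r : ℝ) ^ 2) ∂.volumeIoiPow (d - 1) :=
      integral_prod_mul (fun φ : Metric.sphere (0 : E) 1 => f φ)
        (fun r : Set.Ioi (0 : ℝ) => (r : ℝ) ^ k * Real.exp (-(r : ℝ) ^ 2))
    _ = _ := by
      congr 1
      simp only [Measure.volumeIoiPow, ENNReal.ofReal]
      rw [integral_withDensity_eq_integral_smul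
          (measurable_subtype_coe.pow_const _).real_toNNReal,
        integral_subtype_comap measurableSet_Ioi fun a : ℝ ↦
          Real.toNNReal (a ^ (d - 1)) • (a ^ k * Real.exp (-a ^ 2))]
      have h := integral_pow_mul_exp_neg_sq_Ioi (k + (d - 1))
      -- The truncated subtraction `d - 1` is exact because `0 < d`.
      have hcast : ((k + (d - 1) : ℕ) : ℝ) + 1 = (k : ℝ) + d := by
        rw [← Nat.cast_succ, ← Nat.cast_add]
        congr 1
        omega
      rw [hcast] at h
      rw [← h]
      refine setIntegral_congr_fun measurableSet_Ioi fun x hx ↦ ?_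
      simp only [NNReal.smul_def, Real.coe_toNNReal _ (pow_nonneg (Set.mem_Ioi.mp hx).le _),
        smul_eq_mul]
      ring

variable {N : ℕ} [NeZero N]

instance : IsProbabilityMeasure (uniformSphere N) := by
  constructor
  rw [uniformSphere, Measure.smul_apply, smul_eq_mul]
  refine ENNReal.inv_mul_cancel ?_ (measure_ne_top _ _)
  simp [Measure.measure_univ_eq_zero, -Measure.toSphere_apply_univ]

/-- The polar identity is applied to the exponents `a` and to `0`. The second determines the surface
area, which therefore cancels without being computed. -/
theorem integral_uniformSphere_mul (a : Fin N → ℕ) :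
    (∫ φ : Sphere N, ∏ i, (φ : EuclideanSpace ℝ (Fin N)) i ^ a i ∂uniformSphere N) *
        (Real.Gamma ((((∑ i, a i : ℕ) : ℝ) + N) / 2) * Real.sqrt Real.pi ^ N) =
      Real.Gamma ((N : ℝ) / 2) * ∏ i, ∫ x : ℝ, x ^ a i * Real.exp (-x ^ 2) := by
  have key (b : Fin N → ℕ) := integral_homogeneous_mul_exp_neg_norm_sq
    (volume : Measure (EuclideanSpace ℝ (Fin N))) (fun x => ∏ i, x i ^ b i) (∑ i, b i)
    (fun r x => by simp [mul_pow, Finset.prod_mul_distrib, Finset.prod_pow_eq_pow_sum])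
  simp only [integral_monomial_mul_exp_neg_norm_sq, finrank_euclideanSpace, Fintype.card_fin]
    at key
  have h0 := key 0
  simp only [Pi.zero_apply, pow_zero, one_mul, Finset.prod_const_one, integral_const, smul_eq_mul,
    mul_one, Finset.sum_const_zero, Nat.cast_zero, zero_add, Finset.prod_const, Finset.card_univ,
    Fintype.card_fin] at h0
  have hg : ∫ x : ℝ, Real.exp (-x ^ 2) = Real.sqrt Real.pi := by
    simpa using integral_gaussian 1
  have hΓ : Real.Gamma ((N : ℝ) / 2) ≠ 0 := by
    have : (0 : ℝ) < N := Nat.cast_pos.mpr (NeZero.pos N)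
    exact (Real.Gamma_pos_of_pos (by positivity)).ne'
  set S := (volume : Measure (EuclideanSpace ℝ (Fin N))).toSphere
  have hS : S.real Set.univ ≠ 0 := by
    intro h
    rw [hg, h, zero_mul] at h0
    exact (pow_pos (Real.sqrt_pos.mpr Real.pi_pos) N).ne' h0
  rw [key a, ← hg, h0, uniformSphere, integral_smul_measure, ENNReal.toReal_inv, smul_eq_mul]
  change (S.real Set.univ)⁻¹ * _ * _ = _
  field_simp
  exact mul_comm _ _

/-- The moments of the uniform measure on the unit sphere. -/
theorem integral_uniformSphere_monomial (a : Fin N → ℕ) :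
    ∫ φ : Sphere N, ∏ i, (φ : EuclideanSpace ℝ (Fin N)) i ^ a i ∂uniformSphere N =
      if ∀ i, Even (a i) then
        Real.Gamma ((N : ℝ) / 2) /
          (2 ^ (∑ i, a i / 2) * Real.Gamma (((∑ i, a i / 2 : ℕ) : ℝ) + (N : ℝ) / 2)) *
          ∏ i, ((a i - 1).doubleFactorial : ℝ)
      else 0 := by
  have h := integral_uniformSphere_mul a
  have hN : (0 : ℝ) < N := Nat.cast_pos.mpr (NeZero.pos N)
  have hΓ : Real.Gamma ((((∑ i, a i : ℕ) : ℝ) + N) / 2) ≠ 0 :=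
    (Real.Gamma_pos_of_pos (by positivity)).ne'
  have hπ : Real.sqrt Real.pi ^ N ≠ 0 := (pow_pos (Real.sqrt_pos.mpr Real.pi_pos) N).ne'
  rw [← eq_div_iff (mul_ne_zero hΓ hπ)] at h
  rw [h]
  split_ifs with ha
  -- This is the value of Gamma at half-integers. For `a i = 0` truncation turns `a i - 1` into `0`,
  -- and the double factorial of `0` is `1`, as needed.
  · have hi (i : Fin N) : ∫ x : ℝ, x ^ a i * Real.exp (-x ^ 2) =
        ((a i - 1).doubleFactorial : ℝ) * Real.sqrt Real.pi / 2 ^ (a i / 2) := by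
      obtain ⟨k, hk⟩ := (ha i).two_dvd
      rw [integral_pow_mul_exp_neg_sq_of_even (ha i), hk, Nat.mul_div_cancel_left _ two_pos,
        ← Real.Gamma_nat_add_half]
      congr 1
      push_cast
      ring
    have hs : (((∑ i, a i : ℕ) : ℝ) + N) / 2 = ((∑ i, a i / 2 : ℕ) : ℝ) + (N : ℝ) / 2 := by
      have : ∑ i, a i = 2 * ∑ i, a i / 2 := by
        rw [Finset.mul_sum]
        exact Finset.sum_congr rfl fun i _ => (Nat.two_mul_div_two_of_even (ha i)).symm
      rw [this]
      push_cast
      ring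
    simp only [hi, Finset.prod_div_distrib, Finset.prod_mul_distrib, Finset.prod_const,
      Finset.card_univ, Fintype.card_fin, Finset.prod_pow_eq_pow_sum]
    rw [hs] at hΓ ⊢
    field_simp
  · push Not at ha
    obtain ⟨i, hi⟩ := ha
    rw [Finset.prod_eq_zero (Finset.mem_univ i) (integral_pow_mul_exp_neg_sq_of_not_even hi),
      mul_zero, zero_div]

end SphereMoments

/-! ### Counting paired and unpaired points by colour. -/

section Counts

variable {L C : Type*} [Fintype L] [DecidableEq L] [DecidableEq C]

/-- The number of `i`-coloured fixed points of `σ`. -/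
def fixedCount (c : L → C) (σ : L → L) (i : C) : ℕ :=
  (Finset.univ.filter fun l => c l = i ∧ σ l = l).card

/-- The number of `i`-coloured points moved by `σ`. -/
def movedCount (c : L → C) (σ : L → L) (i : C) : ℕ :=
  (Finset.univ.filter fun l => c l = i ∧ σ l ≠ l).card

/-- The number of `i`-coloured points. -/
def colourCount {L C : Type*} [Fintype L] [DecidableEq C] (c : L → C) (i : C) : ℕ := (Finset.univ.filter fun l => c l = i).card

theorem fixedCount_add_movedCount (c : L → C) (σ : L → L) (i : C) :
    fixedCount c σ i + movedCount c σ i = colourCount c i := by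
  unfold fixedCount movedCount colourCount
  rw [← Finset.card_filter_add_card_filter_not (s := Finset.univ.filter fun l => c l = i)
    (fun l => σ l = l), Finset.filter_filter, Finset.filter_filter]

end Counts

/-! ### Enumeration of colour-preserving involutions. -/

section Involutions

open Equiv.Perm in
theorem cycleType_eq_replicate_two_iff {L : Type*} [Fintype L] [DecidableEq L] (σ : Equiv.Perm L)
    (k : ℕ) : σ.cycleType = Multiset.replicate k 2 ↔ σ ^ 2 = 1 ∧ σ.support.card = 2 * k := by
  constructor
  · intro h
    refine ⟨?_, ?_⟩
    · rw [← orderOf_dvd_iff_pow_eq_one, ← lcm_cycleType, Multiset.lcm_dvd, h]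
      intro b hb
      rw [Multiset.eq_of_mem_replicate hb]
    · rw [← sum_cycleType, h, Multiset.sum_replicate, smul_eq_mul, mul_comm]
  · rintro ⟨h, hs⟩
    have hr := pow_prime_eq_one_iff.mp h
    obtain ⟨n, hn⟩ : ∃ n, σ.cycleType = Multiset.replicate n 2 :=
      ⟨_, Multiset.eq_replicate_card.mpr hr⟩
    rw [← sum_cycleType, hn, Multiset.sum_replicate, smul_eq_mul] at hs
    rw [hn]
    congr 1
    omega

/-- Involutive maps are the permutations of order dividing two. -/
def involutiveEquiv (L : Type*) :
    {σ : L → L // Function.Involutive σ} ≃ {σ : Equiv.Perm L // σ ^ 2 = 1} where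
  toFun σ := ⟨σ.2.toPerm, by
    ext l
    rw [pow_two]
    exact σ.2 l⟩
  invFun σ := ⟨σ.1, fun l => by
    have := Equiv.ext_iff.mp σ.2 l
    rwa [pow_two] at this⟩
  left_inv _ := rfl
  right_inv _ := Subtype.ext (Equiv.ext fun _ => rfl)

/-- The left side is the size of the conjugacy class of `k` disjoint transpositions on `2 * k + ε`
points. -/
theorem factorial_div_eq_doubleFactorial (k ε : ℕ) (hε : ε ≤ 1) :
    (2 * k + ε).factorial / (2 ^ k * k.factorial) = (2 * k + 2 * ε - 1).doubleFactorial := by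
  rw [← Nat.doubleFactorial_two_mul]
  refine Nat.div_eq_of_eq_mul_left (Nat.doubleFactorial_pos _) ?_
  interval_cases ε
  · cases k with
    | zero => rfl
    | succ k =>
      rw [show 2 * (k + 1) + 0 = (2 * k + 1) + 1 by ring, Nat.factorial_eq_mul_doubleFactorial,
        mul_comm]
      rfl
  · exact Nat.factorial_eq_mul_doubleFactorial _

/-- The number of involutions with at most one fixed point. -/
theorem card_involutive (L : Type*) [Fintype L] [DecidableEq L] (ε : ℕ) (hε : ε ≤ 1) :
    Nat.card {σ : L → L // Function.Involutive σ ∧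
        (Finset.univ.filter fun l => σ l = l).card = ε} =
      if Even (Fintype.card L + ε) then (Fintype.card L + ε - 1).doubleFactorial else 0 := by
  have hsupp (σ : Equiv.Perm L) :
      (Finset.univ.filter fun l => σ l = l).card + σ.support.card = Fintype.card L := by
    have := Finset.card_filter_add_card_filter_not (s := (Finset.univ : Finset L))
      (fun l => σ l = l)
    rwa [Finset.card_univ] at this
  have e : {σ : L → L // Function.Involutive σ ∧
        (Finset.univ.filter fun l => σ l = l).card = ε} ≃
      {σ : Equiv.Perm L // σ ^ 2 = 1 ∧ (Finset.univ.filter fun l => σ l = l).card = ε} :=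
    (Equiv.subtypeSubtypeEquivSubtypeInter _ _).symm.trans
      (((involutiveEquiv L).subtypeEquiv fun _ => Iff.rfl).trans
        (Equiv.subtypeSubtypeEquivSubtypeInter _
          fun σ : Equiv.Perm L => (Finset.univ.filter fun l => σ l = l).card = ε))
  rw [Nat.card_congr e]
  split_ifs with h
  -- An involution with `ε` fixed points then consists of exactly `k` transpositions, so the set
  -- being counted is a single cycle type.
  · obtain ⟨k, hk⟩ : ∃ k, Fintype.card L = 2 * k + ε := by
      obtain ⟨j, hj⟩ := h
      exact ⟨j - ε, by omega⟩
    have hiff (σ : Equiv.Perm L) : (σ ^ 2 = 1 ∧ (Finset.univ.filter fun l => σ l = l).card = ε) ↔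
        σ.cycleType = Multiset.replicate k 2 := by
      rw [cycleType_eq_replicate_two_iff]
      have := hsupp σ
      refine and_congr_right fun _ => ?_
      omega
    rw [Nat.card_congr (Equiv.subtypeEquivRight hiff), Nat.card_eq_fintype_card,
      Fintype.card_subtype, Equiv.Perm.card_of_cycleType, if_pos]
    · have hcount : ∏ n ∈ (Multiset.replicate k 2).toFinset,
          (Multiset.count n (Multiset.replicate k 2)).factorial = k.factorial := by
        rcases Nat.eq_zero_or_pos k with rfl | hkpos
        · rfl
        · rw [Multiset.toFinset_replicate, if_neg hkpos.ne', Finset.prod_singleton,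
            Multiset.count_replicate_self]
      have hε1 : (2 * k + ε - k * 2).factorial = 1 := by
        rw [show 2 * k + ε - k * 2 = ε by omega]
        interval_cases ε <;> rfl
      rw [hcount, Multiset.sum_replicate, Multiset.prod_replicate, smul_eq_mul, hk, hε1, one_mul,
        factorial_div_eq_doubleFactorial k ε hε]
      congr 1
      omega
    · refine ⟨?_, fun a ha => (Multiset.eq_of_mem_replicate ha).ge⟩
      rw [Multiset.sum_replicate, smul_eq_mul]
      omega
  · rw [Nat.card_eq_zero]
    -- Parity obstruction: an involution moves an even number of points.
    refine .inl ⟨fun ⟨σ, hσ, hfix⟩ => h ?_⟩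
    obtain ⟨j, hj⟩ := Equiv.Perm.two_dvd_card_support hσ
    have := hsupp σ
    exact ⟨j + ε, by omega⟩

/-- A colour preserving involution is a family of involutions of the colour classes. -/
def involutiveFiberEquiv {L C : Type*} [Fintype L] [DecidableEq L] [DecidableEq C] (c : L → C)
    (ε : C → ℕ) :
    {σ : L → L // (Function.Involutive σ ∧ ∀ l, c (σ l) = c l) ∧
      ∀ i, (Finset.univ.filter fun l => c l = i ∧ σ l = l).card = ε i} ≃
    ∀ i, {τ : {l // c l = i} → {l // c l = i} // Function.Involutive τ ∧
      (Finset.univ.filter fun l => τ l = l).card = ε i} where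
  toFun σ i := ⟨fun l => ⟨σ.1 l, (σ.2.1.2 l).trans l.2⟩, fun l => Subtype.ext (σ.2.1.1 l), by
    rw [← σ.2.2 i, ← Finset.card_map (Function.Embedding.subtype _)]
    congr 1
    ext l
    simp [Subtype.ext_iff, and_comm]⟩
  invFun τ := ⟨fun l => (τ (c l)).1 ⟨l, rfl⟩, ⟨fun l => by
      -- The image of `l` has the colour of `l` only propositionally, so the colour is generalised
      -- to `i` before substituting; `h2` then changes the colour class in which the image is
      -- viewed.
      have h (i : C) (hi : c ((τ (c l)).1 ⟨l, rfl⟩) = i) (hi' : c l = i) :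
          ((τ i).1 ⟨(τ (c l)).1 ⟨l, rfl⟩, hi⟩ : L) = l := by
        subst hi'
        exact congrArg Subtype.val ((τ (c l)).2.1 ⟨l, rfl⟩)
      have hc := ((τ (c l)).1 ⟨l, rfl⟩).2
      have := h _ hc rfl
      have h2 (i j : C) (x : L) (hi : c x = i) (hj : c x = j) :
          ((τ i).1 ⟨x, hi⟩ : L) = (τ j).1 ⟨x, hj⟩ := by
        subst hi; subst hj; rfl
      exact (h2 _ _ _ rfl hc).trans this,
    fun l => ((τ (c l)).1 ⟨l, rfl⟩).2⟩, fun i => by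
      rw [← (τ i).2.2, ← Finset.card_map (Function.Embedding.subtype _)]
      congr 1
      ext l
      simp only [Finset.mem_filter, Finset.mem_univ, true_and, Finset.mem_map,
        Function.Embedding.coe_subtype, Subtype.exists, exists_and_right, exists_eq_right]
      constructor
      · rintro ⟨rfl, h⟩
        exact ⟨rfl, Subtype.ext h⟩
      · rintro ⟨rfl, h⟩
        exact ⟨rfl, congrArg Subtype.val h⟩⟩
  left_inv _ := rfl
  right_inv τ := by
    funext i
    refine Subtype.ext (funext fun l => Subtype.ext ?_)
    obtain ⟨l, rfl⟩ := l
    rfl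

theorem card_involutive_coloured {L C : Type*} [Fintype L] [DecidableEq L] [Fintype C]
    [DecidableEq C] (c : L → C) (ε : C → ℕ) (hε : ∀ i, ε i ≤ 1) :
    Nat.card {σ : L → L // (Function.Involutive σ ∧ ∀ l, c (σ l) = c l) ∧
      ∀ i, fixedCount c σ i = ε i} =
    if ∀ i, Even (colourCount c i + ε i) then
      ∏ i, (colourCount c i + ε i - 1).doubleFactorial else 0 := by
  have hcard (i : C) : Fintype.card {l // c l = i} = colourCount c i := Fintype.card_subtype _
  refine (Nat.card_congr (involutiveFiberEquiv c ε)).trans ?_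
  simp only [Nat.card_pi, card_involutive _ _ (hε _), hcard]
  split_ifs with h
  · exact Finset.prod_congr rfl fun i _ => if_pos (h i)
  · push Not at h
    obtain ⟨i, hi⟩ := h
    exact Finset.prod_eq_zero (Finset.mem_univ i) (if_neg hi)

end Involutions

/-! ### Vertex weights summed over pairings are sphere moments. -/

section LocalWeight

variable {N : ℕ} [NeZero N] {L : Type*} [Fintype L]

theorem coe_spinWeight_of_forall {n u : Fin N → ℕ} (t : ℕ) (h : ∀ i : Fin N, i ≠ 0 → u i = 0) :
    (spinWeight N n u t : ℝ≥0∞) = ENNReal.ofReal (Real.Gamma ((N : ℝ) / 2) /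
      (2 ^ (∑ i, n i) * Real.Gamma (((∑ i, n i : ℕ) : ℝ) + (N : ℝ) / 2))) := by
  have h' : spinWeight N n u t = _ := if_pos h
  rw [h']
  exact (ENNReal.ofReal_eq_coe_nnreal _).symm

theorem spinWeight_of_not_forall {n u : Fin N → ℕ} (t : ℕ) (h : ¬ ∀ i : Fin N, i ≠ 0 → u i = 0) :
    spinWeight N n u t = 0 := if_neg h

theorem pow_mul_prod_eq_monomial (c : L → Fin N) (ε : ℕ) (x : EuclideanSpace ℝ (Fin N)) :
    x 0 ^ ε * ∏ l, x (c l) = ∏ i, x i ^ (colourCount c i + if i = 0 then ε else 0) := by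
  rw [← Finset.prod_fiberwise Finset.univ c]
  simp only [pow_add, Finset.prod_mul_distrib]
  rw [mul_comm]
  congr 1
  · refine Finset.prod_congr rfl fun i _ => ?_
    rw [Finset.prod_congr rfl (g := fun _ => x i), Finset.prod_const,
      colourCount]
    intro l hl
    rw [(Finset.mem_filter.mp hl).2]
  · rw [Finset.prod_eq_single 0]
    · simp
    · intro i _ hi
      simp [hi]
    · simp

/-- Positivity allows `ENNReal.ofReal` to be moved through sums and products of moments. -/
theorem integral_pow_mul_prod_nonneg (c : L → Fin N) (ε : ℕ) :
    0 ≤ ∫ φ : Sphere N, (φ : EuclideanSpace ℝ (Fin N)) 0 ^ ε *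
      ∏ l, (φ : EuclideanSpace ℝ (Fin N)) (c l) ∂uniformSphere N := by
  simp only [pow_mul_prod_eq_monomial, integral_uniformSphere_monomial]
  split_ifs
  · have hN : (0 : ℝ) < N := Nat.cast_pos.mpr (NeZero.pos N)
    positivity
  · exact le_rfl

variable [DecidableEq L]

/-- The contribution of a vertex with pairing `σ` and `ε` required unpaired `1`-links. -/
noncomputable def localWeight (c : L → Fin N) (ε : ℕ) (σ : L → L) : ℝ≥0∞ :=
  if fixedCount c σ 0 = ε then
    -- `spinWeight` ignores its last argument, so `0` can stand for the true value of `t`.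
    (spinWeight N (fun i => movedCount c σ i / 2 + fixedCount c σ i) (fixedCount c σ) 0 : ℝ≥0∞)
  else 0

/-- On admissible pairings the weight no longer depends on `σ`: with `v` moved and `u` fixed points
of a colour, `v / 2 + u` is half of `(v + u) + u`, and `u` is prescribed. -/
theorem localWeight_eq (c : L → Fin N) (ε : ℕ) (σ : L → L) :
    localWeight c ε σ = if ∀ i, fixedCount c σ i = if i = 0 then ε else 0 then
      ENNReal.ofReal (Real.Gamma ((N : ℝ) / 2) /
        (2 ^ (∑ i, (colourCount c i + if i = 0 then ε else 0) / 2) *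
          Real.Gamma (((∑ i, (colourCount c i + if i = 0 then ε else 0) / 2 : ℕ) : ℝ)
            + (N : ℝ) / 2)))
      else 0 := by
  unfold localWeight
  by_cases h : ∀ i, fixedCount c σ i = if i = 0 then ε else 0
  · have h0 : fixedCount c σ 0 = ε := by simpa using h 0
    have h1 : ∀ i : Fin N, i ≠ 0 → fixedCount c σ i = 0 := fun i hi => by simpa [hi] using h i
    have hn (i : Fin N) : movedCount c σ i / 2 + fixedCount c σ i =
        (colourCount c i + if i = 0 then ε else 0) / 2 := by
      rw [← h i, ← fixedCount_add_movedCount c σ i]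
      omega
    rw [if_pos h0, if_pos h, coe_spinWeight_of_forall 0 h1]
    simp only [hn]
  · rw [if_neg h]
    split_ifs with h0
    · rw [spinWeight_of_not_forall, ENNReal.coe_zero]
      refine fun h1 => h fun i => ?_
      split_ifs with hi
      · rw [hi, h0]
      · exact h1 i hi
    · rfl

/-- Summing the local weights over all pairings gives a moment of the uniform measure. -/
theorem tsum_localWeight (c : L → Fin N) (ε : ℕ) (hε : ε ≤ 1) :
    ∑' σ : {σ : L → L // Function.Involutive σ ∧ ∀ l, c (σ l) = c l}, localWeight c ε σ.1 =
      ENNReal.ofReal (∫ φ : Sphere N, (φ : EuclideanSpace ℝ (Fin N)) 0 ^ ε *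
        ∏ l, (φ : EuclideanSpace ℝ (Fin N)) (c l) ∂uniformSphere N) := by
  classical
  set δ : Fin N → ℕ := fun i => if i = 0 then ε else 0
  have hδ (i : Fin N) : δ i ≤ 1 := by
    simp only [δ]
    split_ifs <;> omega
  simp only [pow_mul_prod_eq_monomial, integral_uniformSphere_monomial, localWeight_eq]
  -- A constant weight turns the sum into that weight times the number of admissible pairings. The
  -- count and the moment vanish under the same parity condition.
  rw [tsum_fintype, ← Finset.sum_filter, Finset.sum_const, nsmul_eq_mul, ← Fintype.card_subtype,
    ← Nat.card_eq_fintype_card, Nat.card_congr (Equiv.subtypeSubtypeEquivSubtypeInter _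
      fun σ : L → L => ∀ i, fixedCount c σ i = δ i)]
  rw [card_involutive_coloured c δ hδ]
  split_ifs with h
  · rw [← ENNReal.ofReal_natCast, ← ENNReal.ofReal_mul (Nat.cast_nonneg _), mul_comm,
      Nat.cast_prod]
  · simp

end LocalWeight

/-! ### Multivariate exponential series. -/

section ExpExpansion

/-- Fubini for counting measure: the product of counting measures on `ℕ` is counting measure on `E →
ℕ`. -/
theorem hasSum_prod_pi {E : Type*} [Fintype E] (f : E → ℕ → ℝ) (hf : ∀ e, Summable (f e)) :
    HasSum (fun m : E → ℕ => ∏ e, f e (m e)) (∏ e, ∑' k, f e k) := by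
  classical
  have hcount : Measure.pi (fun _ : E => (Measure.count : Measure ℕ)) = Measure.count := by
    refine Measure.ext_of_singleton fun m => ?_
    rw [Measure.pi_singleton]
    simp
  have hint (e : E) : Integrable (f e) Measure.count := by
    rw [integrable_count_iff]
    exact (hf e).norm
  have h : Integrable (fun m : E → ℕ => ∏ e, f e (m e))
      (Measure.pi fun _ : E => (Measure.count : Measure ℕ)) := Integrable.fintype_prod hint
  have h' := integral_fintype_prod_eq_prod (μ := fun _ : E => (Measure.count : Measure ℕ)) f
  rw [hcount] at h h'
  have hs : Summable (fun m : E → ℕ => ∏ e, f e (m e)) := (integrable_count_iff.mp h).of_norm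
  rw [integral_countable h] at h'
  have h'' (e : E) : ∫ k, f e k ∂Measure.count = ∑' k, f e k := by
    rw [integral_countable (hint e)]
    simp
  simp only [h'', measureReal_def, Measure.count_singleton, ENNReal.toReal_one, one_smul] at h'
  rw [← h']
  exact hs.hasSum

theorem hasSum_exp_sum {E : Type*} [Fintype E] (a : E → ℝ) :
    HasSum (fun m : E → ℕ => ∏ e, a e ^ m e / (m e).factorial) (Real.exp (∑ e, a e)) := by
  have h := hasSum_prod_pi (fun e k => a e ^ k / (k.factorial : ℝ))
    fun e => Real.summable_pow_div_factorial (a e)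
  rw [Real.exp_sum]
  simpa only [Real.exp_eq_exp_ℝ, NormedSpace.exp_eq_tsum_div] using h

end ExpExpansion

/-! ### Expansion of products of edge inner products into colourings. -/

section Expansion

variable {V : Type*} [Fintype V] [DecidableEq V] {G : SimpleGraph V} {N : ℕ}

/-- Writing each summand as a product over all vertices lets the products over links and vertices be
exchanged later. Looplessness of `G` makes the two end-points distinct factors. -/
theorem edgeInner_eq_sum (φ : V → Sphere N) (e : G.edgeSet) :
    edgeInner φ e = ∑ i, ∏ x, if x ∈ (e : Sym2 V) then
      (φ x : EuclideanSpace ℝ (Fin N)) i else 1 := by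
  obtain ⟨e, he⟩ := e
  induction e using Sym2.ind with
  | _ x y =>
    have hxy : x ≠ y := G.ne_of_adj he
    change inner ℝ (φ x : EuclideanSpace ℝ (Fin N)) (φ y) = _
    rw [PiLp.inner_apply]
    refine Finset.sum_congr rfl fun i _ => ?_
    rw [← Finset.prod_filter]
    have : (Finset.univ.filter fun z => z ∈ s(x, y)) = {x, y} := by
      ext z
      simp
    simp only [this, Finset.prod_pair hxy]
    simp [mul_comm]

theorem prod_edgeInner_pow [DecidableRel G.Adj] (φ : V → Sphere N) (m : LinkCount G) :
    ∏ e : G.edgeSet, edgeInner φ e ^ m e =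
      ∑ c : Colouring m N, ∏ x, ∏ l : LinkAt m x,
        (φ x : EuclideanSpace ℝ (Fin N)) (c l.1) := by
  have h1 : ∏ e : G.edgeSet, edgeInner φ e ^ m e = ∏ l : Link m, edgeInner φ l.1 := by
    rw [Fintype.prod_sigma]
    simp
  rw [h1]
  simp only [edgeInner_eq_sum]
  rw [Fintype.prod_sum]
  refine Finset.sum_congr rfl fun c _ => ?_
  rw [Finset.prod_comm]
  refine Finset.prod_congr rfl fun x _ => ?_
  rw [← Finset.prod_filter]
  exact Finset.prod_subtype _ (by simp) _

end Expansion

/-! ### Integration of the expansion against the product measure. -/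

section Integrals

variable {V : Type*} {G : SimpleGraph V} {N : ℕ}

theorem abs_sphere_apply_le_one (φ : Sphere N) (i : Fin N) :
    |(φ : EuclideanSpace ℝ (Fin N)) i| ≤ 1 := by
  have h := PiLp.norm_apply_le (φ : EuclideanSpace ℝ (Fin N)) i
  rwa [norm_eq_of_mem_sphere] at h

theorem abs_edgeInner_le_one (φ : V → Sphere N) (e : Sym2 V) : |edgeInner φ e| ≤ 1 := by
  induction e using Sym2.ind with
  | _ x y =>
    change |inner ℝ (φ x : EuclideanSpace ℝ (Fin N)) (φ y)| ≤ 1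
    have h := abs_real_inner_le_norm (φ x : EuclideanSpace ℝ (Fin N)) (φ y)
    rwa [norm_eq_of_mem_sphere, norm_eq_of_mem_sphere, one_mul] at h

theorem continuous_edgeInner (e : Sym2 V) :
    Continuous fun φ : V → Sphere N => edgeInner φ e := by
  induction e using Sym2.ind with
  | _ x y =>
    change Continuous fun φ : V → Sphere N =>
      (inner ℝ (φ x : EuclideanSpace ℝ (Fin N)) (φ y) : ℝ)
    fun_prop

variable [Fintype V] [NeZero N]

theorem integrable_of_continuous {f : (V → Sphere N) → ℝ} (hf : Continuous f) :
    Integrable f (Measure.pi fun _ => uniformSphere N) :=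
  hf.integrable_of_hasCompactSupport (HasCompactSupport.of_compactSpace f)

theorem spinPartition_pos (G : SimpleGraph V) [DecidableRel G.Adj] (N : ℕ) [NeZero N] (β : ℝ) :
    0 < spinPartition G N β := by
  refine integral_exp_pos (integrable_of_continuous ?_)
  have (e : Sym2 V) := continuous_edgeInner (N := N) e
  unfold hamiltonian
  fun_prop

theorem integral_prod_mul_prod_edgeInner_pow [DecidableEq V] [DecidableRel G.Adj]
    (m : LinkCount G) (A : Finset V) :
    ∫ φ : V → Sphere N, (∏ x ∈ A, (φ x : EuclideanSpace ℝ (Fin N)) 0) *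
        ∏ e : G.edgeSet, edgeInner φ e ^ m e ∂(Measure.pi fun _ => uniformSphere N) =
      ∑ c : Colouring m N, ∏ x, ∫ φ : Sphere N,
        (φ : EuclideanSpace ℝ (Fin N)) 0 ^ (if x ∈ A then 1 else 0) *
          ∏ l : LinkAt m x, (φ : EuclideanSpace ℝ (Fin N)) (c l.1) ∂uniformSphere N := by
  simp only [prod_edgeInner_pow, Finset.mul_sum]
  rw [integral_finsetSum]
  · refine Finset.sum_congr rfl fun c _ => ?_
    rw [← integral_fintype_prod_eq_prod fun x (φ : Sphere N) =>
      (φ : EuclideanSpace ℝ (Fin N)) 0 ^ (if x ∈ A then 1 else 0) *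
          ∏ l : LinkAt m x, (φ : EuclideanSpace ℝ (Fin N)) (c l.1)]
    refine integral_congr_ae (.of_forall fun φ => ?_)
    simp only [Finset.prod_mul_distrib]
    congr 1
    simp only [pow_ite, pow_one, pow_zero, ← Finset.prod_filter, Finset.filter_mem_eq_inter,
      Finset.univ_inter]
  · intro c _
    refine integrable_of_continuous ?_
    fun_prop

/-- The high-temperature expansion of the unnormalised correlations. -/
theorem hasSum_integral_prod_mul_exp [DecidableEq V] [DecidableRel G.Adj] (β : ℝ≥0)
    (A : Finset V) :
    HasSum (fun m : LinkCount G => (∏ e : G.edgeSet, (β : ℝ) ^ m e / (m e).factorial) *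
        ∑ c : Colouring m N, ∏ x, ∫ φ : Sphere N,
          (φ : EuclideanSpace ℝ (Fin N)) 0 ^ (if x ∈ A then 1 else 0) *
            ∏ l : LinkAt m x, (φ : EuclideanSpace ℝ (Fin N)) (c l.1) ∂uniformSphere N)
      (∫ φ : V → Sphere N, (∏ x ∈ A, (φ x : EuclideanSpace ℝ (Fin N)) 0) *
        Real.exp (-β * hamiltonian G φ) ∂(Measure.pi fun _ => uniformSphere N)) := by
  set F : LinkCount G → (V → Sphere N) → ℝ := fun m φ =>
    (∏ e : G.edgeSet, (β : ℝ) ^ m e / (m e).factorial) *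
      ((∏ x ∈ A, (φ x : EuclideanSpace ℝ (Fin N)) 0) * ∏ e : G.edgeSet, edgeInner φ e ^ m e)
  have hcont (m : LinkCount G) : Continuous (F m) := by
    have (e : G.edgeSet) := continuous_edgeInner (N := N) (e : Sym2 V)
    fun_prop
  have hF (φ : V → Sphere N) : HasSum (fun m => F m φ)
      ((∏ x ∈ A, (φ x : EuclideanSpace ℝ (Fin N)) 0) * Real.exp (-β * hamiltonian G φ)) := by
    have h := (hasSum_exp_sum fun e : G.edgeSet => (β : ℝ) * edgeInner φ e).mul_left
      (∏ x ∈ A, (φ x : EuclideanSpace ℝ (Fin N)) 0)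
    convert! h using 1
    · funext m
      simp only [F, mul_pow, mul_div_right_comm, Finset.prod_mul_distrib]
      ring
    · have hs : ∑ e ∈ G.edgeFinset, edgeInner φ e = ∑ e : G.edgeSet, edgeInner φ e :=
        Finset.sum_subtype _ (fun _ => SimpleGraph.mem_edgeFinset) _
      rw [hamiltonian, hs, ← Finset.mul_sum, neg_mul_neg]
  have hb (m : LinkCount G) : 0 ≤ ∏ e : G.edgeSet, (β : ℝ) ^ m e / (m e).factorial :=
    Finset.prod_nonneg fun e _ => by positivity
  -- All spin factors are at most `1` in absolute value, so the terms are dominated uniformly in `φ`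
  -- by a summable exponential series. This justifies exchanging sum and integral.
  have hbound (m : LinkCount G) (φ : V → Sphere N) :
      ‖F m φ‖ ≤ ∏ e : G.edgeSet, (β : ℝ) ^ m e / (m e).factorial := by
    rw [norm_mul, Real.norm_of_nonneg (hb m), norm_mul, norm_prod, norm_prod]
    refine mul_le_of_le_one_right (hb m) (mul_le_one₀ ?_ (Finset.prod_nonneg fun _ _ =>
      norm_nonneg _) ?_)
    · exact Finset.prod_le_one (fun _ _ => norm_nonneg _) fun x _ => abs_sphere_apply_le_one _ _
    · refine Finset.prod_le_one (fun _ _ => norm_nonneg _) fun e _ => ?_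
      rw [norm_pow]
      exact pow_le_one₀ (norm_nonneg _) (abs_edgeInner_le_one _ _)
  have key := hasSum_integral_of_summable_integral_norm
    (μ := Measure.pi fun _ : V => uniformSphere N) (F := F)
    (fun m => integrable_of_continuous (hcont m))
    (Summable.of_nonneg_of_le (fun m => integral_nonneg fun _ => norm_nonneg _)
      (fun m => by
        refine (integral_mono (integrable_of_continuous (hcont m).norm)
          (integrable_const _) (hbound m)).trans ?_
        simp)
      (hasSum_exp_sum fun _ : G.edgeSet => (β : ℝ)).summable)
  simp only [(hF _).tsum_eq] at key
  convert! key using 1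
  funext m
  simp only [F]
  rw [integral_const_mul, integral_prod_mul_prod_edgeInner_pow]

end Integrals

/-! ### Identification of the path measure with spin correlations. -/

section PathMeasure

variable {V : Type*} [Fintype V] [DecidableEq V] {G : SimpleGraph V} [DecidableRel G.Adj] {N : ℕ}

/-- A wire configuration is a link configuration, a colouring and a pairing. -/
def wireConfigEquiv (G : SimpleGraph V) (N : ℕ) :
    WireConfig G N ≃ Σ (m : LinkCount G) (c : Colouring m N), Pairing m c where
  toFun w := ⟨w.m, w.c, w.π⟩
  invFun p := ⟨p.1, p.2.1, p.2.2⟩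
  left_inv _ := rfl
  right_inv _ := rfl

theorem tsum_pi_prod {ι : Type*} [Fintype ι] {κ : ι → Type*} [∀ i, Finite (κ i)]
    (f : ∀ i, κ i → ℝ≥0∞) :
    ∑' p : ∀ i, κ i, ∏ i, f i (p i) = ∏ i, ∑' k, f i k := by
  classical
  have (i : ι) : Fintype (κ i) := Fintype.ofFinite _
  simp only [tsum_fintype, Fintype.prod_sum]

variable [NeZero N]

/-- Membership in `S_A` is a condition at each vertex separately, so its indicator can be absorbed
into the vertex weights. -/
theorem weight_mul_indicator (β : ℝ≥0) (A : Finset V) (w : WireConfig G N) :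
    (weight β (spinWeight N) w : ℝ≥0∞) * (endpointSet G A).indicator 1 w =
      ENNReal.ofReal (∏ e : G.edgeSet, (β : ℝ) ^ w.m e / (w.m e).factorial) *
        ∏ x, localWeight (fun l : LinkAt w.m x => w.c l.1) (if x ∈ A then 1 else 0) (w.π x).1 := by
  have hb : ENNReal.ofReal (∏ e : G.edgeSet, (β : ℝ) ^ w.m e / (w.m e).factorial) =
      ((∏ e : G.edgeSet, β ^ w.m e / ((w.m e).factorial : ℝ≥0) : ℝ≥0) : ℝ≥0∞) := by
    rw [← ENNReal.ofReal_coe_nnreal]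
    push_cast
    rfl
  have hu (x : V) : w.u x 0 = fixedCount (fun l : LinkAt w.m x => w.c l.1) (w.π x).1 0 := rfl
  rw [hb]
  by_cases h : w ∈ endpointSet G A
  · rw [Set.indicator_of_mem h, Pi.one_apply, mul_one, weight, ENNReal.coe_mul, ENNReal.ofNNReal_finsetProd
      (s := Finset.univ) (f := fun x => spinWeight N (w.n x) (w.u x) (w.t x))]
    congr 1
    refine Finset.prod_congr rfl fun x _ => ?_
    rw [localWeight, if_pos]
    · rfl
    · rw [← hu]
      split_ifs with hx
      · exact h.1 x hx
      · exact h.2 x hx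
  · rw [Set.indicator_of_notMem h, mul_zero]
    obtain ⟨x, hx⟩ : ∃ x, w.u x 0 ≠ if x ∈ A then 1 else 0 := by
      by_contra! hc
      exact h ⟨fun x hx => by simpa [hx] using hc x, fun x hx => by simpa [hx] using hc x⟩
    rw [Finset.prod_eq_zero (Finset.mem_univ x), mul_zero]
    rw [localWeight, if_neg]
    exact hx

theorem pathMeasure_endpointSet (β : ℝ≥0) (A : Finset V) :
    pathMeasure G β (spinWeight N) (endpointSet G A) =
      ENNReal.ofReal (∫ φ : V → Sphere N, (∏ x ∈ A, (φ x : EuclideanSpace ℝ (Fin N)) 0) *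
        Real.exp (-β * hamiltonian G φ) ∂(Measure.pi fun _ => uniformSphere N)) := by
  have h := hasSum_integral_prod_mul_exp (N := N) (G := G) β A
  have hb (m : LinkCount G) : 0 ≤ ∏ e : G.edgeSet, (β : ℝ) ^ m e / (m e).factorial :=
    Finset.prod_nonneg fun e _ => by positivity
  have hmom (m : LinkCount G) (c : Colouring m N) (x : V) :=
    integral_pow_mul_prod_nonneg (fun l : LinkAt m x => c l.1) (if x ∈ A then 1 else 0)
  have hprod (m : LinkCount G) (c : Colouring m N) :=
    Finset.prod_nonneg fun x (_ : x ∈ Finset.univ) => hmom m c x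
  have hsum (m : LinkCount G) := Finset.sum_nonneg fun c (_ : c ∈ Finset.univ) => hprod m c
  rw [← h.tsum_eq, ENNReal.ofReal_tsum_of_nonneg (fun m => mul_nonneg (hb m) (hsum m)) h.summable,
    pathMeasure, Measure.sum_apply _ (MeasurableSpace.measurableSet_top)]
  simp only [Measure.smul_apply, smul_eq_mul,
    Measure.dirac_apply' _ (MeasurableSpace.measurableSet_top (s := endpointSet G A)),
    weight_mul_indicator]
  -- The sum over configurations is split into sums over `m`, `c` and `π`. For fixed `m` and `c` the
  -- pairings at different vertices are independent, so the last sum is a product of local sums.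
  rw [← (wireConfigEquiv G N).symm.tsum_eq, ENNReal.tsum_sigma']
  refine tsum_congr fun m => ?_
  rw [ENNReal.tsum_sigma', tsum_fintype, ENNReal.ofReal_mul (hb m),
    ENNReal.ofReal_sum_of_nonneg fun c _ => hprod m c, Finset.mul_sum]
  refine Finset.sum_congr rfl fun c _ => ?_
  rw [ENNReal.ofReal_prod_of_nonneg fun x _ => hmom m c x]
  simp only [wireConfigEquiv, Equiv.coe_fn_symm_mk]
  rw [ENNReal.tsum_mul_left]
  congr 1
  refine (tsum_pi_prod fun x (σ : {σ : LinkAt m x → LinkAt m x //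
    Function.Involutive σ ∧ ∀ l : LinkAt m x, c (σ l).1 = c l.1}) =>
      localWeight (fun l : LinkAt m x => c l.1) (if x ∈ A then 1 else 0) σ.1).trans ?_
  refine Finset.prod_congr rfl fun x _ => ?_
  exact tsum_localWeight (fun l : LinkAt m x => c l.1) _ (by split_ifs <;> omega)

theorem pathMeasure_endpointSet_empty (β : ℝ≥0) :
    pathMeasure G β (spinWeight N) (endpointSet G ∅) =
      ENNReal.ofReal (spinPartition G N β) := by
  simp [pathMeasure_endpointSet, spinPartition]

/-- The convention for a null `S_∅` never applies, because the mass of `S_∅` is the strictly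
positive spin partition function. -/
theorem partitionFunction_spinWeight (β : ℝ≥0) (A : Finset V) :
    partitionFunction G β (spinWeight N) A =
      pathMeasure G β (spinWeight N) (endpointSet G A) := by
  refine if_neg fun h => ?_
  rw [pathMeasure_endpointSet_empty, ENNReal.ofReal_eq_zero] at h
  exact (spinPartition_pos G N β).not_ge h.2

/-- Unnormalised correlations of the spin model are non-negative. -/
theorem integral_prod_mul_exp_nonneg (β : ℝ≥0) (A : Finset V) :
    0 ≤ ∫ φ : V → Sphere N, (∏ x ∈ A, (φ x : EuclideanSpace ℝ (Fin N)) 0) *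
      Real.exp (-β * hamiltonian G φ) ∂(Measure.pi fun _ => uniformSphere N) :=
  (hasSum_integral_prod_mul_exp β A).nonneg fun m =>
    mul_nonneg (Finset.prod_nonneg fun e _ => by positivity) <|
      Finset.sum_nonneg fun c _ => Finset.prod_nonneg fun x _ =>
        integral_pow_mul_prod_nonneg (fun l : LinkAt m x => c l.1) _

end PathMeasure

end RandomPath

theorem proposition2p1 {V : Type*} [Fintype V] [DecidableEq V] (G : SimpleGraph V)
    [DecidableRel G.Adj] (N : ℕ) [NeZero N] (β : ℝ≥0) :
    (∀ A : Finset V,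
      RandomPath.pathMeasure G β (RandomPath.spinWeight N) (RandomPath.endpointSet G A) < ∞) ∧
    ∀ A : Finset V,
      RandomPath.spinExpectation G N β
          (fun φ => ∏ x ∈ A, (φ x : EuclideanSpace ℝ (Fin N)) 0) =
        RandomPath.twoPoint G β (RandomPath.spinWeight N) A := by
  refine ⟨fun A => ?_, fun A => ?_⟩
  · rw [RandomPath.pathMeasure_endpointSet]
    exact ENNReal.ofReal_lt_top
  · rw [RandomPath.twoPoint, RandomPath.partitionFunction_spinWeight,
      RandomPath.partitionFunction_spinWeight, RandomPath.pathMeasure_endpointSet_empty,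
      RandomPath.pathMeasure_endpointSet,
      ENNReal.toReal_ofReal (RandomPath.integral_prod_mul_exp_nonneg β A),
      ENNReal.toReal_ofReal (RandomPath.spinPartition_pos G N β).le, RandomPath.spinExpectation,
      inv_mul_eq_div]
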